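/- Let $X$ be a set of letters with a weight $|x|\in\{1,2,3,\dots\}$ for each $x\in X$, such that for every $n\ge 1$ there are infinitely many letters of weight $n$. Let $Sh(X)$ be the $\mathbf{Q}$-vector space with basis the words over $X$; the weight of a word is the sum of the weights of its letters, and the empty word is written $1$. Let $\mathbin{\sqcup\!\sqcup}$ be the shuffle product of words, let $\prec$ be the bilinear half-shuffle with $(yu)\prec v=y\,(u \mathbin{\sqcup\!\sqcup} v)$ for a letter $y$ and words $u,v$, and $1\prec v=0$ for every word $v$ (including $v=1$), let $a\succ b:=b\prec a$, and let $\Delta$ be the deconcatenation coproduct. For $f,g\in End(Sh(X))$ put $f\prec g=\prec\circ(f\otimes g)\circ\Delta$ and $f\succ g=\succ\circ(f\otimes g)\circ\Delta$. Let $p_n$ ($n\ge 0$) be the projection of $Sh(X)$ onto the span of the words of weight $n$ that kills all words of other weights. The dendriform descent algebra $\mathbf{Descd}$ is the smallest subspace of $End(Sh(X))$ that contains all $p_n$, $n\ge 0$, and is closed under the two half-products. For a permutation $\sigma$ of $\{1,\dots,k\}$ and $d:\{1,\dots,k\}\to\{1,2,\dots\}$, let $(\sigma,d)\in End(Sh(X))$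 send a word $x_1\cdots x_k$ with $|x_{\sigma(i)}|=d(i)$ for all $i$ to $x_{\sigma(1)}\cdots x_{\sigma(k)}$, and every other word to $0$. Let $\mathbf{S}_n$ be the span of the $(\sigma,d)$ with $d(1)+\dots+d(k)=n$, and $\mathbf{Descd}_n=\mathbf{Descd}\cap\mathbf{S}_n$. Then $\mathbf{Descd}=\bigoplus_{n\ge 0}\mathbf{Descd}_n$, every $\mathbf{Descd}_n$ is finite-dimensional, and, as formal power series over $\mathbf{Q}$, $$\sum_{n\ge 0}\dim(\mathbf{Descd}_n)\,x^n=\frac{1-x-\sqrt{(1-x)(1-5x)}}{2x},$$ where the square root is the one with constant term $1$. This series is the Catalan series $C(y)=\sum_{n\ge0}\frac1{n+1}\binom{2n}{n}y^n$ composed with $y=\frac{x}{1-x}$. The dimensions for $n=0,\dots,9$ are $1,1,3,10,36,137,543,2219,9285,39587$ (sequence A002212 of the OEIS). -/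

import Mathlib

open scoped TensorProduct

noncomputable section

namespace GradedShuffle

/-- The underlying space of the shuffle algebra over the alphabet `X`: the rational vector space
with basis the words (lists) over `X`. -/
abbrev Sh (X : Type*) : Type _ := List X →₀ ℚ

variable {X : Type*}

/-- Left multiplication by a letter, for concatenation. -/
def consLetter (y : X) : Sh X →ₗ[ℚ] Sh X := Finsupp.lmapDomain ℚ ℚ (List.cons y)

/-- The shuffle product of two words. -/
def shuffleWord : List X → List X → Sh X
  | [], v => Finsupp.single v 1
  | y :: u, [] => Finsupp.single (y :: u) 1
  | y :: u, z :: v =>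
      consLetter y (shuffleWord u (z :: v)) + consLetter z (shuffleWord (y :: u) v)
  termination_by u v => u.length + v.length

/-- The left half-shuffle of two words: the part of the shuffle product whose words begin with
the first letter of the left factor. With the empty word `1` the conventions are
`1 ≺ w = 0` (in particular `1 ≺ 1 = 0`) and `w ≺ 1 = w` for nonempty `w`. -/
def halfShuffleWord : List X → List X → Sh X
  | [], _ => 0
  | y :: u, v => consLetter y (shuffleWord u v)

/-- The left half-shuffle `≺` on the shuffle algebra. -/
def halfShuffle : Sh X →ₗ[ℚ] Sh X →ₗ[ℚ] Sh X :=
  Finsupp.linearCombination ℚ fun u : List X =>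
    Finsupp.linearCombination ℚ fun v : List X => halfShuffleWord u v

/-- The deconcatenation coproduct. -/
def deconc : Sh X →ₗ[ℚ] Sh X ⊗[ℚ] Sh X :=
  Finsupp.linearCombination ℚ fun w : List X =>
    ∑ k ∈ Finset.range (w.length + 1),
      (Finsupp.single (w.take k) 1 : Sh X) ⊗ₜ[ℚ] (Finsupp.single (w.drop k) 1 : Sh X)

/-- The half-product `f ≺ g = ≺ ∘ (f ⊗ g) ∘ Δ` of endomorphisms. -/
def endPrec (f g : Module.End ℚ (Sh X)) : Module.End ℚ (Sh X) :=
  TensorProduct.lift halfShuffle ∘ₗ TensorProduct.map f g ∘ₗ deconc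

/-- The half-product `f ≻ g = ≻ ∘ (f ⊗ g) ∘ Δ` of endomorphisms, where `a ≻ b = b ≺ a`. -/
def endSucc (f g : Module.End ℚ (Sh X)) : Module.End ℚ (Sh X) :=
  TensorProduct.lift halfShuffle.flip ∘ₗ TensorProduct.map f g ∘ₗ deconc

/-- The weight of a word: the sum of the weights of its letters. -/
def weight (deg : X → ℕ+) (w : List X) : ℕ := (w.map fun x => (deg x : ℕ)).sum

/-- The projection `p_n` onto the span of the words of weight `n`. -/
def proj (deg : X → ℕ+) (n : ℕ) : Module.End ℚ (Sh X) :=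
  Finsupp.linearCombination ℚ fun w : List X =>
    if weight deg w = n then (Finsupp.single w 1 : Sh X) else 0

/-- The endomorphism of the shuffle algebra given by the graded permutation `(σ, d)`: it sends
`x_1 ⋯ x_k` to `x_{σ(1)} ⋯ x_{σ(k)}` if `x_{σ(i)}` has weight `d(i)` for all `i`, and it sends all
other words to zero. -/
def gradedPermEnd (deg : X → ℕ+) {k : ℕ} (σ : Equiv.Perm (Fin k)) (d : Fin k → ℕ+) :
    Module.End ℚ (Sh X) :=
  Finsupp.linearCombination ℚ fun w : List X =>
    if h : w.length = k then
      if ∀ i : Fin k, deg (w.get (Fin.cast h.symm (σ i))) = d i then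
        (Finsupp.single (List.ofFn fun i : Fin k => w.get (Fin.cast h.symm (σ i))) 1 : Sh X)
      else 0
    else 0

/-- The component of degree `n` of the space of graded permutations, as a space of
endomorphisms: the span of the `(σ, d)` for which the values of `d` sum to `n`. -/
def gradedPermComponent (deg : X → ℕ+) (n : ℕ) : Submodule ℚ (Module.End ℚ (Sh X)) :=
  Submodule.span ℚ
    {f | ∃ (k : ℕ) (σ : Equiv.Perm (Fin k)) (d : Fin k → ℕ+),
      ∑ i, (d i : ℕ) = n ∧ f = gradedPermEnd deg σ d}

/-- The dendriform descent algebra: the smallest subspace of `End(Sh(X))` that contains all the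
projections `p_n`, `n ≥ 0`, and is closed under both half-products. -/
def descd (deg : X → ℕ+) : Submodule ℚ (Module.End ℚ (Sh X)) :=
  sInf {M | (∀ n : ℕ, proj deg n ∈ M) ∧
    ∀ f ∈ M, ∀ g ∈ M, endPrec f g ∈ M ∧ endSucc f g ∈ M}

/-- The component of degree `n` of the dendriform descent algebra. -/
def descdComponent (deg : X → ℕ+) (n : ℕ) : Submodule ℚ (Module.End ℚ (Sh X)) :=
  descd deg ⊓ gradedPermComponent deg n

/-- The formal series `∑ dim(Descd_n) x^n` of the dendriform descent algebra. -/
def descdSeries (deg : X → ℕ+) : PowerSeries ℚ :=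
  PowerSeries.mk fun n => (Module.finrank ℚ (descdComponent deg n) : ℚ)

end GradedShuffle

end

noncomputable section

namespace GradedShuffle

variable {X : Type*}

/-! ### The shuffle algebra -/

/-! A binary tree with labels in `ℕ` is read as an endomorphism: the empty tree is `p_0`, and a node
with label `a` and subtrees `l`, `r` is `l ≻ (p_{a+1} ≺ r)`. These endomorphisms form a basis of the
dendriform descent algebra, and a basis of each component once the trees are sorted by weight.

Spanning: by coassociativity of deconcatenation, the dendriform identities of the half-shuffles pass
to the convolution products. They peel the root off one factor, so induction on the number of nodes
closes the span of the trees under both half-products (`conv_treeEnd_mem`, `descd_eq_treeSpan`).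

Independence: for a tree of distinct letters, apply a tree endomorphism with at least as many nodes
to the inorder word and read the coefficient of the preorder word. It is 1 for the tree of labels
and 0 for every other such tree (`treeEnd_inorder_preorder`).

Grading: tree endomorphisms commute with weight-preserving substitutions of letters. Since every
weight has infinitely many letters, their values on words without repetitions determine them, so
they are combinations of graded permutations (`IsGradedNatural.mem_gradedPermComponent`).
Composition with `p_n` then separates the degrees.

Counting trees by their root gives `T = 1 + x/(1-x) * T^2`, from which the closed form, the Catalan
substitution and the dimensions follow. -/

/-- A word, as an element of the shuffle algebra. -/
abbrev word (w : List X) : Sh X := Finsupp.single w 1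

/-- The shuffle product. -/
def shuffle : Sh X →ₗ[ℚ] Sh X →ₗ[ℚ] Sh X :=
  Finsupp.linearCombination ℚ fun u : List X =>
    Finsupp.linearCombination ℚ fun v : List X => shuffleWord u v

@[simp] theorem consLetter_word (y : X) (w : List X) : consLetter y (word w) = word (y :: w) := by
  simp [consLetter, Finsupp.mapDomain_single]

theorem shuffle_word (u v : List X) : shuffle (word u) (word v) = shuffleWord u v := by
  simp [shuffle]

theorem halfShuffle_word (u v : List X) :
    halfShuffle (word u) (word v) = halfShuffleWord u v := by
  simp [halfShuffle]

/-- Two linear maps on the shuffle algebra that agree on words are equal. -/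
theorem linearMap_ext_word {M : Type*} [AddCommMonoid M] [Module ℚ M] {f g : Sh X →ₗ[ℚ] M}
    (h : ∀ w, f (word w) = g (word w)) : f = g :=
  Finsupp.lhom_ext' fun w => LinearMap.ext_ring (h w)

@[simp] theorem shuffle_nil_left (b : Sh X) : shuffle (word []) b = b := by
  have : shuffle (word ([] : List X)) = LinearMap.id := linearMap_ext_word fun v => by
    simp [shuffle_word, shuffleWord]
  simp [this]

@[simp] theorem shuffle_nil_right (a : Sh X) : shuffle a (word []) = a := by
  have : shuffle.flip (word ([] : List X)) = LinearMap.id := linearMap_ext_word fun v => by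
    cases v <;> simp [shuffle_word, shuffleWord]
  simpa using LinearMap.congr_fun this a

@[simp] theorem halfShuffle_nil_left (b : Sh X) : halfShuffle (word []) b = 0 := by
  have : halfShuffle (word ([] : List X)) = 0 := linearMap_ext_word fun v => by
    simp [halfShuffle_word, halfShuffleWord]
  simp [this]

@[simp] theorem halfShuffle_consLetter (y : X) (a b : Sh X) :
    halfShuffle (consLetter y a) b = consLetter y (shuffle a b) := by
  have : halfShuffle ∘ₗ consLetter y = shuffle.compr₂ (consLetter y) :=
    linearMap_ext_word fun u => linearMap_ext_word fun v => by
      simp [halfShuffle_word, halfShuffleWord, shuffle_word]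
  simpa using LinearMap.congr_fun₂ this a b

theorem shuffle_consLetter_consLetter (y z : X) (a b : Sh X) :
    shuffle (consLetter y a) (consLetter z b) =
      consLetter y (shuffle a (consLetter z b)) + consLetter z (shuffle (consLetter y a) b) := by
  have : shuffle.compl₁₂ (consLetter y) (consLetter z) =
      (shuffle.compl₂ (consLetter z)).compr₂ (consLetter y) +
      (shuffle ∘ₗ consLetter y).compr₂ (consLetter z) :=
    linearMap_ext_word fun u => linearMap_ext_word fun v => by
      simp [shuffle_word, shuffleWord]
  simpa using LinearMap.congr_fun₂ this a b

theorem shuffle_comm (a b : Sh X) : shuffle a b = shuffle b a := by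
  suffices h : ∀ n : ℕ, ∀ u v : List X, u.length + v.length = n →
      shuffle (word u) (word v) = shuffle (word v) (word u) by
    have : (shuffle : Sh X →ₗ[ℚ] _) = shuffle.flip :=
      linearMap_ext_word fun u => linearMap_ext_word fun v => h _ u v rfl
    exact LinearMap.congr_fun₂ this a b
  intro n
  induction n with
  | zero =>
    intro u v h
    have hu : u = [] := List.length_eq_zero_iff.mp (by omega)
    have hv : v = [] := List.length_eq_zero_iff.mp (by omega)
    rw [hu, hv]
  | succ n ih =>
    rintro (_ | ⟨y, u⟩) (_ | ⟨z, v⟩) h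
    · simp
    · simp
    · simp
    · simp only [List.length_cons] at h
      rw [← consLetter_word y u, ← consLetter_word z v, shuffle_consLetter_consLetter,
        shuffle_consLetter_consLetter, add_comm, consLetter_word, consLetter_word,
        ih u (z :: v) (by simp; omega), ih (y :: u) v (by simp; omega)]

theorem shuffle_assoc (a b c : Sh X) :
    shuffle (shuffle a b) c = shuffle a (shuffle b c) := by
  suffices h : ∀ n : ℕ, ∀ u v w : List X, u.length + v.length + w.length = n →
      shuffle (shuffle (word u) (word v)) (word w) =
        shuffle (word u) (shuffle (word v) (word w)) by
    have : (shuffle : Sh X →ₗ[ℚ] _).compr₂ shuffle =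
        (LinearMap.llcomp ℚ (Sh X) (Sh X) (Sh X)).compl₁₂ shuffle shuffle :=
      linearMap_ext_word fun u => linearMap_ext_word fun v => linearMap_ext_word fun w => by
        simpa using h _ u v w rfl
    simpa using LinearMap.congr_fun (LinearMap.congr_fun₂ this a b) c
  intro n
  induction n with
  | zero =>
    intro u v w h
    have hu : u = [] := List.length_eq_zero_iff.mp (by omega)
    simp [hu]
  | succ n ih =>
    rintro (_ | ⟨x, u⟩) (_ | ⟨y, v⟩) (_ | ⟨z, w⟩) h
    all_goals try simp only [shuffle_nil_left, shuffle_nil_right]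
    simp only [List.length_cons] at h
    have h1 := ih u (y :: v) (z :: w) (by simp; omega)
    have h2 := ih (x :: u) v (z :: w) (by simp; omega)
    have h3 := ih (x :: u) (y :: v) w (by simp; omega)
    simp only [← consLetter_word] at h1 h2 h3 ⊢
    simp only [shuffle_consLetter_consLetter, map_add, LinearMap.add_apply] at h1 h2 h3 ⊢
    -- The terms are sorted by first letter `x`, `y` or `z`, one induction hypothesis for each. The
    -- third is used backwards because it is its left side that was expanded into a sum.
    rw [h1, h2, ← h3]
    simp only [map_add]
    abel

/-- The first letter of `a` stays in front, and behind it this is associativity of the shuffle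
product. -/
theorem halfShuffle_halfShuffle (a b c : Sh X) :
    halfShuffle (halfShuffle a b) c = halfShuffle a (shuffle b c) := by
  have : ∀ u, halfShuffle (halfShuffle (word u) b) c = halfShuffle (word u) (shuffle b c) := by
    rintro (_ | ⟨y, u⟩)
    · simp
    · simp only [← consLetter_word, halfShuffle_consLetter, shuffle_assoc]
  have h2 : halfShuffle.flip c ∘ₗ halfShuffle.flip b = halfShuffle.flip (shuffle b c) :=
    linearMap_ext_word this
  exact LinearMap.congr_fun h2 a

/-- In terms of `≻` this is the mixed dendriform identity `(b ≻ a) ≺ c = b ≻ (a ≺ c)`. -/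
theorem halfShuffle_right_comm (a b c : Sh X) :
    halfShuffle (halfShuffle a b) c = halfShuffle (halfShuffle a c) b := by
  rw [halfShuffle_halfShuffle, halfShuffle_halfShuffle, shuffle_comm]

theorem consLetter_apply_nil (y : X) (a : Sh X) : consLetter y a [] = 0 :=
  Finsupp.mapDomain_of_notMem_range _ _ (by simp)

theorem consLetter_apply_cons (y : X) (a : Sh X) (v : List X) :
    consLetter y a (y :: v) = a v :=
  Finsupp.mapDomain_apply (List.cons_injective) _ _

theorem consLetter_apply_cons_of_ne {x y : X} (h : x ≠ y) (a : Sh X) (v : List X) :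
    consLetter y a (x :: v) = 0 :=
  Finsupp.mapDomain_of_notMem_range _ _ (by simp [h.symm])

theorem halfShuffle_apply_nil (a b : Sh X) : halfShuffle a b [] = 0 := by
  have h : (Finsupp.lapply [] : Sh X →ₗ[ℚ] ℚ) ∘ₗ halfShuffle.flip b = 0 := by
    refine linearMap_ext_word ?_
    rintro (_ | ⟨y, u⟩)
    · simp
    · rw [← consLetter_word]
      simp [consLetter_apply_nil, -consLetter_word]
  exact LinearMap.congr_fun h a

theorem halfShuffle_nil_right (a : Sh X) (ha : a [] = 0) : halfShuffle a (word []) = a := by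
  have h : halfShuffle.flip (word []) =
      LinearMap.id - (Finsupp.lapply [] : Sh X →ₗ[ℚ] ℚ).smulRight (word []) := by
    refine linearMap_ext_word ?_
    rintro (_ | ⟨y, u⟩)
    · simp
    · simp only [← consLetter_word]
      simp only [LinearMap.flip_apply, halfShuffle_consLetter, shuffle_nil_right]
      simp
  simpa [ha] using LinearMap.congr_fun h a

/-- The last term is needed because `1 ≺ 1 = 0`: neither half-product sees the product of the
constant terms. -/
theorem shuffle_eq_add (a b : Sh X) :
    shuffle a b = halfShuffle a b + halfShuffle b a + (a [] * b []) • word [] := by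
  have h : shuffle = (halfShuffle : Sh X →ₗ[ℚ] _) + halfShuffle.flip +
      ((LinearMap.mul ℚ ℚ).compl₁₂ (Finsupp.lapply []) (Finsupp.lapply [])).compr₂
        (LinearMap.id.smulRight (word [])) := by
    refine linearMap_ext_word fun u => linearMap_ext_word fun v => ?_
    rcases u with _ | ⟨y, u⟩ <;> rcases v with _ | ⟨z, v⟩
    · simp
    · simp [halfShuffle_nil_right]
    · simp [halfShuffle_nil_right]
    · simp [shuffle_word, shuffleWord, halfShuffle_word, halfShuffleWord]
      rw [← shuffle_word v, ← shuffle_word, shuffle_comm]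
  simpa using LinearMap.congr_fun₂ h a b

/-! ### Convolution products of endomorphisms -/

/-- The convolution of endomorphisms with respect to a bilinear product and deconcatenation. -/
def conv (B : Sh X →ₗ[ℚ] Sh X →ₗ[ℚ] Sh X) :
    Module.End ℚ (Sh X) →ₗ[ℚ] Module.End ℚ (Sh X) →ₗ[ℚ] Module.End ℚ (Sh X) :=
  LinearMap.mk₂ ℚ (fun f g => TensorProduct.lift B ∘ₗ TensorProduct.map f g ∘ₗ deconc)
    (by intros; simp [TensorProduct.map_add_left, LinearMap.add_comp, LinearMap.comp_add])
    (by intros; simp [TensorProduct.map_smul_left, LinearMap.smul_comp, LinearMap.comp_smul])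
    (by intros; simp [TensorProduct.map_add_right, LinearMap.add_comp, LinearMap.comp_add])
    (by intros; simp [TensorProduct.map_smul_right, LinearMap.smul_comp, LinearMap.comp_smul])

/-- The sum of the values of a function over all the splittings of a word in two. -/
def splitSum {M : Type*} [AddCommMonoid M] (Φ : List X → List X → M) (w : List X) : M :=
  ∑ k ∈ Finset.range (w.length + 1), Φ (w.take k) (w.drop k)

section splitSum

variable {M : Type*} [AddCommMonoid M]

@[simp] theorem splitSum_nil (Φ : List X → List X → M) : splitSum Φ [] = Φ [] [] := by
  simp [splitSum]

@[simp] theorem splitSum_cons (Φ : List X → List X → M) (x : X) (w : List X) :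
    splitSum Φ (x :: w) = Φ [] (x :: w) + splitSum (fun a b => Φ (x :: a) b) w := by
  rw [splitSum, List.length_cons, Finset.sum_range_succ', add_comm]
  simp [splitSum]

theorem splitSum_add (Φ Ψ : List X → List X → M) (w : List X) :
    splitSum (fun a b => Φ a b + Ψ a b) w = splitSum Φ w + splitSum Ψ w :=
  Finset.sum_add_distrib

/-- Coassociativity of deconcatenation: both sides run over the splittings of `w` into three. -/
theorem splitSum_coassoc (Ψ : List X → List X → List X → M) (w : List X) :
    splitSum (fun a c => splitSum (fun a' b => Ψ a' b c) a) w =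
      splitSum (fun a bc => splitSum (fun b c => Ψ a b c) bc) w := by
  induction w generalizing Ψ with
  | nil => simp
  | cons x w ih => simp [splitSum_add, ih fun a b c => Ψ (x :: a) b c, add_assoc]

end splitSum

theorem map_splitSum {M N : Type*} [AddCommMonoid M] [AddCommMonoid N] [Module ℚ M] [Module ℚ N]
    (f : M →ₗ[ℚ] N) (Φ : List X → List X → M) (w : List X) :
    f (splitSum Φ w) = splitSum (fun a b => f (Φ a b)) w :=
  map_sum f _ _

theorem conv_apply_word (B : Sh X →ₗ[ℚ] Sh X →ₗ[ℚ] Sh X) (f g : Module.End ℚ (Sh X))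
    (w : List X) :
    conv B f g (word w) = splitSum (fun a b => B (f (word a)) (g (word b))) w := by
  simp [conv, deconc, splitSum]

/-- Four independent products let one coassociativity argument serve all three dendriform
identities. -/
theorem conv_conv {B₁ B₂ B₃ B₄ : Sh X →ₗ[ℚ] Sh X →ₗ[ℚ] Sh X}
    (h : ∀ a b c, B₁ (B₂ a b) c = B₃ a (B₄ b c)) (f g k : Module.End ℚ (Sh X)) :
    conv B₁ (conv B₂ f g) k = conv B₃ f (conv B₄ g k) := by
  refine linearMap_ext_word fun w => ?_
  simp only [conv_apply_word, map_splitSum]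
  rw [← splitSum_coassoc fun a b c => B₃ (f (word a)) (B₄ (g (word b)) (k (word c)))]
  congr 1
  ext1 a; ext1 c
  exact (map_splitSum (LinearMap.applyₗ (k (word c))) _ a).trans (by simp [h])

theorem conv_prec_prec (f g h : Module.End ℚ (Sh X)) :
    conv halfShuffle (conv halfShuffle f g) h = conv halfShuffle f (conv shuffle g h) :=
  conv_conv halfShuffle_halfShuffle f g h

theorem conv_succ_prec (f g h : Module.End ℚ (Sh X)) :
    conv halfShuffle (conv halfShuffle.flip f g) h =
      conv halfShuffle.flip f (conv halfShuffle g h) :=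
  conv_conv (fun a b c => halfShuffle_right_comm b a c) f g h

theorem conv_succ_succ (f g h : Module.End ℚ (Sh X)) :
    conv halfShuffle.flip (conv shuffle f g) h =
      conv halfShuffle.flip f (conv halfShuffle.flip g h) :=
  conv_conv (fun a b c => by
    simp only [LinearMap.flip_apply]
    rw [halfShuffle_halfShuffle, shuffle_comm]) f g h

/-! ### The endomorphisms attached to labelled binary trees -/

section splitSum

variable {M : Type*} [AddCommMonoid M]

theorem splitSum_eq_zero {Φ : List X → List X → M} {w : List X}
    (h : ∀ a b, a ++ b = w → Φ a b = 0) : splitSum Φ w = 0 :=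
  Finset.sum_eq_zero fun k _ => h _ _ (List.take_append_drop k w)

theorem splitSum_eq_nil_left {Φ : List X → List X → M} (h : ∀ x a b, Φ (x :: a) b = 0)
    (w : List X) : splitSum Φ w = Φ [] w := by
  cases w with
  | nil => simp
  | cons x w => simp [h, splitSum_eq_zero]

theorem splitSum_eq_nil_right {Φ : List X → List X → M} (h : ∀ a y b, Φ a (y :: b) = 0)
    (w : List X) : splitSum Φ w = Φ w [] := by
  induction w generalizing Φ with
  | nil => simp
  | cons x w ih => simp [h, ih fun a y b => h (x :: a) y b]

end splitSum

theorem proj_word (deg : X → ℕ+) (n : ℕ) (w : List X) :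
    proj deg n (word w) = if weight deg w = n then word w else 0 := by
  simp [proj]

@[simp] theorem weight_nil (deg : X → ℕ+) : weight deg [] = 0 := rfl

@[simp] theorem weight_cons (deg : X → ℕ+) (x : X) (w : List X) :
    weight deg (x :: w) = deg x + weight deg w := by
  simp [weight]

@[simp] theorem weight_append (deg : X → ℕ+) (v w : List X) :
    weight deg (v ++ w) = weight deg v + weight deg w := by
  simp [weight]

@[simp] theorem proj_zero_nil (deg : X → ℕ+) : proj deg 0 (word []) = word [] := by
  simp [proj_word]

@[simp] theorem proj_zero_cons (deg : X → ℕ+) (x : X) (w : List X) :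
    proj deg 0 (word (x :: w)) = 0 := by
  simp [proj_word]

/-- All weights are positive, so `p_0` keeps only the empty word and only the splitting with empty
left part survives. -/
theorem conv_proj_zero_left (deg : X → ℕ+) (B : Sh X →ₗ[ℚ] Sh X →ₗ[ℚ] Sh X)
    (f : Module.End ℚ (Sh X)) : conv B (proj deg 0) f = B (word []) ∘ₗ f :=
  linearMap_ext_word fun w => by
    rw [conv_apply_word, splitSum_eq_nil_left (by simp)]
    simp

theorem conv_proj_zero_right (deg : X → ℕ+) (B : Sh X →ₗ[ℚ] Sh X →ₗ[ℚ] Sh X)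
    (f : Module.End ℚ (Sh X)) : conv B f (proj deg 0) = B.flip (word []) ∘ₗ f :=
  linearMap_ext_word fun w => by
    rw [conv_apply_word, splitSum_eq_nil_right (by simp)]
    simp

theorem conv_shuffle_proj_zero_left (deg : X → ℕ+) (f : Module.End ℚ (Sh X)) :
    conv shuffle (proj deg 0) f = f := by
  rw [conv_proj_zero_left]
  exact linearMap_ext_word fun w => by simp

theorem conv_prec_proj_zero_left (deg : X → ℕ+) (f : Module.End ℚ (Sh X)) :
    conv halfShuffle (proj deg 0) f = 0 := by
  rw [conv_proj_zero_left]
  exact linearMap_ext_word fun w => by simp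

theorem conv_succ_proj_zero_right (deg : X → ℕ+) (f : Module.End ℚ (Sh X)) :
    conv halfShuffle.flip f (proj deg 0) = 0 := by
  rw [conv_proj_zero_right]
  exact linearMap_ext_word fun w => by simp

theorem conv_prec_proj_zero_right (deg : X → ℕ+) {f : Module.End ℚ (Sh X)}
    (hf : ∀ w, f (word w) [] = 0) : conv halfShuffle f (proj deg 0) = f := by
  rw [conv_proj_zero_right]
  exact linearMap_ext_word fun w => by simp [halfShuffle_nil_right _ (hf w)]

theorem conv_succ_proj_zero_left (deg : X → ℕ+) {f : Module.End ℚ (Sh X)}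
    (hf : ∀ w, f (word w) [] = 0) : conv halfShuffle.flip (proj deg 0) f = f := by
  rw [conv_proj_zero_left]
  exact linearMap_ext_word fun w => by simp [halfShuffle_nil_right _ (hf w)]

theorem conv_shuffle_eq_add {f g : Module.End ℚ (Sh X)} (hf : ∀ w, f (word w) [] = 0) :
    conv shuffle f g = conv halfShuffle f g + conv halfShuffle.flip f g :=
  linearMap_ext_word fun w => by
    simp only [LinearMap.add_apply, conv_apply_word, ← splitSum_add]
    congr 1
    ext1 a; ext1 b
    simp [shuffle_eq_add, hf]

theorem proj_succ_apply_nil (deg : X → ℕ+) (n : ℕ) (w : List X) :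
    proj deg (n + 1) (word w) [] = 0 := by
  rw [proj_word]
  split_ifs with h
  · cases w with
    | nil => simp at h
    | cons x w => simp
  · rfl

/-- The endomorphism attached to a binary tree; a node with label `a` stands for the
projection on the words of weight `a + 1`. -/
def treeEnd (deg : X → ℕ+) : BinaryTree ℕ → Module.End ℚ (Sh X)
  | .nil => proj deg 0
  | .node a l r =>
      conv halfShuffle.flip (treeEnd deg l) (conv halfShuffle (proj deg (a + 1)) (treeEnd deg r))

theorem treeEnd_node_apply_nil (deg : X → ℕ+) (a : ℕ) (l r : BinaryTree ℕ) (w : List X) :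
    treeEnd deg (.node a l r) (word w) [] = 0 := by
  rw [treeEnd, conv_apply_word]
  refine (map_splitSum (Finsupp.lapply [] : Sh X →ₗ[ℚ] ℚ) _ w).trans
    (splitSum_eq_zero fun _ _ _ => ?_)
  simp [halfShuffle_apply_nil]

/-- The span of the endomorphisms attached to binary trees. -/
def treeSpan (deg : X → ℕ+) : Submodule ℚ (Module.End ℚ (Sh X)) :=
  Submodule.span ℚ (Set.range (treeEnd deg))

theorem treeEnd_mem (deg : X → ℕ+) (t : BinaryTree ℕ) : treeEnd deg t ∈ treeSpan deg :=
  Submodule.subset_span ⟨t, rfl⟩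

theorem treeEnd_leaf (deg : X → ℕ+) (a : ℕ) :
    treeEnd deg (.node a .nil .nil) = proj deg (a + 1) := by
  simp only [treeEnd]
  rw [conv_prec_proj_zero_right, conv_succ_proj_zero_left] <;> exact proj_succ_apply_nil deg a

theorem node_right_mem (deg : X → ℕ+) (a : ℕ) (l : BinaryTree ℕ) {g : Module.End ℚ (Sh X)}
    (hg : g ∈ treeSpan deg) :
    conv halfShuffle.flip (treeEnd deg l) (conv halfShuffle (proj deg (a + 1)) g) ∈
      treeSpan deg := by
  have : treeSpan deg ≤ (treeSpan deg).comap
      (conv halfShuffle.flip (treeEnd deg l) ∘ₗ conv halfShuffle (proj deg (a + 1))) :=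
    Submodule.span_le.mpr (by
      rintro _ ⟨r, rfl⟩
      exact treeEnd_mem deg (.node a l r))
  exact this hg

theorem node_left_mem (deg : X → ℕ+) (a : ℕ) (r : BinaryTree ℕ) {g : Module.End ℚ (Sh X)}
    (hg : g ∈ treeSpan deg) :
    conv halfShuffle.flip g (conv halfShuffle (proj deg (a + 1)) (treeEnd deg r)) ∈
      treeSpan deg := by
  have : treeSpan deg ≤ (treeSpan deg).comap
      ((conv halfShuffle.flip).flip (conv halfShuffle (proj deg (a + 1)) (treeEnd deg r))) :=
    Submodule.span_le.mpr (by
      rintro _ ⟨l, rfl⟩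
      exact treeEnd_mem deg (.node a l r))
  exact this hg

/-- The identities `(l ≻ (p ≺ r)) ≺ s = l ≻ (p ≺ (r ⧢ s))` and `t ≻ (l ≻ (p ≺ r)) = (t ⧢ l) ≻ (p ≺
r)` leave a shuffle convolution of trees with fewer nodes in total. Since that convolution is the
sum of the two half-products, the three claims go through one induction. -/
theorem conv_treeEnd_mem (deg : X → ℕ+) (t s : BinaryTree ℕ) :
    conv halfShuffle (treeEnd deg t) (treeEnd deg s) ∈ treeSpan deg ∧
    conv halfShuffle.flip (treeEnd deg t) (treeEnd deg s) ∈ treeSpan deg ∧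
    conv shuffle (treeEnd deg t) (treeEnd deg s) ∈ treeSpan deg := by
  induction hn : t.numNodes + s.numNodes using Nat.strong_induction_on generalizing t s with
  | _ n ih =>
  have h1 : conv halfShuffle (treeEnd deg t) (treeEnd deg s) ∈ treeSpan deg := by
    cases t with
    | nil => simp [treeEnd, conv_prec_proj_zero_left]
    | node a l r =>
      rw [treeEnd, conv_succ_prec, conv_prec_prec]
      exact node_right_mem deg a l (ih _ (by simp at hn; omega) r s rfl).2.2
  have h2 : conv halfShuffle.flip (treeEnd deg t) (treeEnd deg s) ∈ treeSpan deg := by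
    cases s with
    | nil => simp [treeEnd, conv_succ_proj_zero_right]
    | node a l r =>
      rw [treeEnd, ← conv_succ_succ]
      exact node_left_mem deg a r (ih _ (by simp at hn; omega) t l rfl).2.2
  refine ⟨h1, h2, ?_⟩
  cases t with
  | nil =>
    rw [treeEnd, conv_shuffle_proj_zero_left]
    exact treeEnd_mem deg s
  | node a l r =>
    rw [conv_shuffle_eq_add (treeEnd_node_apply_nil deg a l r)]
    exact add_mem h1 h2

theorem proj_mem_descd (deg : X → ℕ+) (n : ℕ) : proj deg n ∈ descd deg :=
  Submodule.mem_sInf.mpr fun _ hM => hM.1 n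

theorem endPrec_mem_descd (deg : X → ℕ+) {f g : Module.End ℚ (Sh X)}
    (hf : f ∈ descd deg) (hg : g ∈ descd deg) : endPrec f g ∈ descd deg :=
  Submodule.mem_sInf.mpr fun M hM =>
    (hM.2 f (Submodule.mem_sInf.mp hf M hM) g (Submodule.mem_sInf.mp hg M hM)).1

theorem endSucc_mem_descd (deg : X → ℕ+) {f g : Module.End ℚ (Sh X)}
    (hf : f ∈ descd deg) (hg : g ∈ descd deg) : endSucc f g ∈ descd deg :=
  Submodule.mem_sInf.mpr fun M hM =>
    (hM.2 f (Submodule.mem_sInf.mp hf M hM) g (Submodule.mem_sInf.mp hg M hM)).2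

theorem treeEnd_mem_descd (deg : X → ℕ+) (t : BinaryTree ℕ) : treeEnd deg t ∈ descd deg := by
  induction t with
  | nil => exact proj_mem_descd deg 0
  | node a l r hl hr =>
    exact endSucc_mem_descd deg hl (endPrec_mem_descd deg (proj_mem_descd deg _) hr)

theorem descd_eq_treeSpan (deg : X → ℕ+) : descd deg = treeSpan deg := by
  refine le_antisymm (sInf_le ⟨?_, fun f hf g hg => ⟨?_, ?_⟩⟩) (Submodule.span_le.mpr ?_)
  · rintro (_ | n)
    · exact treeEnd_mem deg .nil
    · rw [← treeEnd_leaf]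
      exact treeEnd_mem deg _
  · refine LinearMap.BilinMap.apply_apply_mem_of_mem_span _ _ _ (conv halfShuffle) ?_ f g hf hg
    rintro _ ⟨t, rfl⟩ _ ⟨s, rfl⟩
    exact (conv_treeEnd_mem deg t s).1
  · refine LinearMap.BilinMap.apply_apply_mem_of_mem_span _ _ _ (conv halfShuffle.flip) ?_ f g hf hg
    rintro _ ⟨t, rfl⟩ _ ⟨s, rfl⟩
    exact (conv_treeEnd_mem deg t s).2.1
  · rintro _ ⟨t, rfl⟩
    exact treeEnd_mem_descd deg t

/-! ### Natural endomorphisms are combinations of graded permutations -/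

/-- The substitution of letters, extended to the shuffle algebra. -/
def mapWord (φ : X → X) : Sh X →ₗ[ℚ] Sh X := Finsupp.lmapDomain ℚ ℚ (List.map φ)

@[simp] theorem mapWord_word (φ : X → X) (w : List X) :
    mapWord φ (word w) = word (w.map φ) := by
  simp [mapWord, Finsupp.mapDomain_single]

theorem mapWord_consLetter (φ : X → X) (y : X) (a : Sh X) :
    mapWord φ (consLetter y a) = consLetter (φ y) (mapWord φ a) := by
  have : mapWord φ ∘ₗ consLetter y = consLetter (φ y) ∘ₗ mapWord φ :=
    linearMap_ext_word fun w => by simp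
  exact LinearMap.congr_fun this a

theorem mapWord_shuffle (φ : X → X) (a b : Sh X) :
    mapWord φ (shuffle a b) = shuffle (mapWord φ a) (mapWord φ b) := by
  suffices h : ∀ n : ℕ, ∀ u v : List X, u.length + v.length = n →
      mapWord φ (shuffle (word u) (word v)) =
        shuffle (mapWord φ (word u)) (mapWord φ (word v)) by
    have : (shuffle : Sh X →ₗ[ℚ] _).compr₂ (mapWord φ) =
        shuffle.compl₁₂ (mapWord φ) (mapWord φ) :=
      linearMap_ext_word fun u => linearMap_ext_word fun v => h _ u v rfl
    exact LinearMap.congr_fun₂ this a b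
  intro n
  induction n with
  | zero =>
    intro u v h
    have hu : u = [] := List.length_eq_zero_iff.mp (by omega)
    simp [hu]
  | succ n ih =>
    rintro (_ | ⟨y, u⟩) (_ | ⟨z, v⟩) h
    · simp
    · simp
    · simp
    · simp only [List.length_cons] at h
      have h1 := ih u (z :: v) (by simp; omega)
      have h2 := ih (y :: u) v (by simp; omega)
      simp only [← consLetter_word] at h1 h2 ⊢
      simp only [shuffle_consLetter_consLetter, map_add, mapWord_consLetter, h1, h2]

theorem mapWord_halfShuffle (φ : X → X) (a b : Sh X) :
    mapWord φ (halfShuffle a b) = halfShuffle (mapWord φ a) (mapWord φ b) := by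
  have : mapWord φ ∘ₗ halfShuffle.flip b = halfShuffle.flip (mapWord φ b) ∘ₗ mapWord φ := by
    refine linearMap_ext_word ?_
    rintro (_ | ⟨y, u⟩)
    · simp
    · simp only [← consLetter_word, LinearMap.comp_apply, LinearMap.flip_apply,
        halfShuffle_consLetter, mapWord_consLetter, mapWord_shuffle]
  exact LinearMap.congr_fun this a

/-- The span of the rearrangements of a word. -/
def permSpan (w : List X) : Submodule ℚ (Sh X) :=
  Submodule.span ℚ {a | ∃ v : List X, v.Perm w ∧ a = word v}

theorem word_mem_permSpan {v w : List X} (h : v.Perm w) : word v ∈ permSpan w :=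
  Submodule.subset_span ⟨v, h, rfl⟩

theorem permSpan_congr {v w : List X} (h : v.Perm w) : permSpan v = permSpan w := by
  have : ∀ u : List X, u.Perm v ↔ u.Perm w := fun u => ⟨fun k => k.trans h, fun k => k.trans h.symm⟩
  simp only [permSpan, this]

theorem consLetter_mem_permSpan {y : X} {a : Sh X} {w : List X} (h : a ∈ permSpan w) :
    consLetter y a ∈ permSpan (y :: w) := by
  have : permSpan w ≤ (permSpan (y :: w)).comap (consLetter y) := Submodule.span_le.mpr (by
    rintro _ ⟨v, hv, rfl⟩
    simpa using word_mem_permSpan (hv.cons y))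
  exact this h

theorem shuffle_word_mem_permSpan (u v : List X) :
    shuffle (word u) (word v) ∈ permSpan (u ++ v) := by
  induction hn : u.length + v.length generalizing u v with
  | zero =>
    have hu : u = [] := List.length_eq_zero_iff.mp (by omega)
    simpa [hu] using word_mem_permSpan (List.Perm.refl v)
  | succ n ih =>
    rcases u with _ | ⟨y, u⟩
    · simpa using word_mem_permSpan (List.Perm.refl v)
    rcases v with _ | ⟨z, v⟩
    · simpa using word_mem_permSpan (List.Perm.refl (y :: u))
    simp only [List.length_cons] at hn
    have h1 := consLetter_mem_permSpan (y := y) (ih u (z :: v) (by simp; omega))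
    have h2 := consLetter_mem_permSpan (y := z) (ih (y :: u) v (by simp; omega))
    rw [← permSpan_congr (List.perm_middle (l₁ := y :: u))] at h2
    simp only [← consLetter_word] at h1 h2 ⊢
    rw [shuffle_consLetter_consLetter]
    exact add_mem h1 h2

theorem halfShuffle_word_mem_permSpan (u v : List X) :
    halfShuffle (word u) (word v) ∈ permSpan (u ++ v) := by
  rcases u with _ | ⟨y, u⟩
  · simp
  · rw [← consLetter_word, halfShuffle_consLetter]
    exact consLetter_mem_permSpan (shuffle_word_mem_permSpan u v)

theorem bilin_mem_permSpan {B : Sh X →ₗ[ℚ] Sh X →ₗ[ℚ] Sh X}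
    (hB : ∀ u v, B (word u) (word v) ∈ permSpan (u ++ v)) {a b : Sh X} {u v : List X}
    (ha : a ∈ permSpan u) (hb : b ∈ permSpan v) : B a b ∈ permSpan (u ++ v) := by
  refine LinearMap.BilinMap.apply_apply_mem_of_mem_span _ _ _ B ?_ a b ha hb
  rintro _ ⟨u', hu, rfl⟩ _ ⟨v', hv, rfl⟩
  rw [← permSpan_congr (hu.append hv)]
  exact hB u' v'

theorem halfShuffle_flip_word_mem_permSpan (u v : List X) :
    halfShuffle.flip (word u) (word v) ∈ permSpan (u ++ v) := by
  rw [permSpan_congr List.perm_append_comm]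
  exact halfShuffle_word_mem_permSpan v u

/-- An endomorphism that lives on the words of weight `n`, rearranges the letters of words, and
commutes with the substitutions of letters that preserve weights. -/
structure IsGradedNatural (deg : X → ℕ+) (n : ℕ) (f : Module.End ℚ (Sh X)) : Prop where
  apply_of_ne : ∀ w, weight deg w ≠ n → f (word w) = 0
  map_comm : ∀ φ : X → X, (∀ x, deg (φ x) = deg x) → ∀ w,
    f (word (w.map φ)) = mapWord φ (f (word w))
  mem_permSpan : ∀ w, f (word w) ∈ permSpan w

theorem weight_map {deg : X → ℕ+} {φ : X → X} (hφ : ∀ x, deg (φ x) = deg x) (w : List X) :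
    weight deg (w.map φ) = weight deg w := by
  simp [weight, Function.comp_def, hφ]

theorem isGradedNatural_proj (deg : X → ℕ+) (n : ℕ) : IsGradedNatural deg n (proj deg n) where
  apply_of_ne w h := by simp [proj_word, h]
  map_comm φ hφ w := by
    rw [proj_word, proj_word, weight_map hφ]
    split_ifs <;> simp
  mem_permSpan w := by
    rw [proj_word]
    split_ifs
    · exact word_mem_permSpan (List.Perm.refl w)
    · exact zero_mem _

theorem splitSum_map {M : Type*} [AddCommMonoid M] (Φ : List X → List X → M) (φ : X → X)
    (w : List X) : splitSum Φ (w.map φ) = splitSum (fun a b => Φ (a.map φ) (b.map φ)) w := by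
  simp [splitSum]

theorem IsGradedNatural.conv {deg : X → ℕ+} {B : Sh X →ₗ[ℚ] Sh X →ₗ[ℚ] Sh X}
    (hB : ∀ u v, B (word u) (word v) ∈ permSpan (u ++ v))
    (hmap : ∀ φ a b, mapWord φ (B a b) = B (mapWord φ a) (mapWord φ b))
    {m n : ℕ} {f g : Module.End ℚ (Sh X)} (hf : IsGradedNatural deg m f)
    (hg : IsGradedNatural deg n g) : IsGradedNatural deg (m + n) (conv B f g) where
  apply_of_ne w h := by
    rw [conv_apply_word]
    refine splitSum_eq_zero fun a b hab => ?_
    by_cases ha : weight deg a = m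
    · have hb : weight deg b ≠ n := by
        rintro rfl
        exact h (by rw [← hab, weight_append, ha])
      simp [hg.apply_of_ne b hb]
    · simp [hf.apply_of_ne a ha]
  map_comm φ hφ w := by
    rw [conv_apply_word, conv_apply_word, map_splitSum, splitSum_map]
    simp only [hf.map_comm φ hφ, hg.map_comm φ hφ, hmap]
  mem_permSpan w := by
    rw [conv_apply_word]
    refine sum_mem fun k _ => ?_
    have := bilin_mem_permSpan hB (hf.mem_permSpan (w.take k)) (hg.mem_permSpan (w.drop k))
    rwa [List.take_append_drop] at this

/-- The weight of a labelled tree; the label `a` has weight `a + 1`. -/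
def treeWeight : BinaryTree ℕ → ℕ
  | .nil => 0
  | .node a l r => treeWeight l + (a + 1 + treeWeight r)

theorem isGradedNatural_treeEnd (deg : X → ℕ+) (t : BinaryTree ℕ) :
    IsGradedNatural deg (treeWeight t) (treeEnd deg t) := by
  induction t with
  | nil => exact isGradedNatural_proj deg 0
  | node a l r hl hr =>
    rw [treeEnd, treeWeight]
    refine IsGradedNatural.conv halfShuffle_flip_word_mem_permSpan (fun φ a b => ?_) hl ?_
    · rw [LinearMap.flip_apply, LinearMap.flip_apply, mapWord_halfShuffle]
    · exact IsGradedNatural.conv halfShuffle_word_mem_permSpan mapWord_halfShuffle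
        (isGradedNatural_proj deg (a + 1)) hr

/-! #### From natural endomorphisms to graded permutations -/

theorem gradedPermEnd_ofFn (deg : X → ℕ+) {k : ℕ} (σ : Equiv.Perm (Fin k)) (d : Fin k → ℕ+)
    (u : Fin k → X) : gradedPermEnd deg σ d (word (List.ofFn u)) =
      if ∀ i, deg (u (σ i)) = d i then word (List.ofFn (u ∘ σ)) else 0 := by
  simp [gradedPermEnd, Function.comp_def]

theorem gradedPermEnd_of_length_ne (deg : X → ℕ+) {k : ℕ} (σ : Equiv.Perm (Fin k))
    (d : Fin k → ℕ+) {w : List X} (h : w.length ≠ k) :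
    gradedPermEnd deg σ d (word w) = 0 := by
  simp [gradedPermEnd, h]

theorem exists_eq_ofFn {k : ℕ} {w : List X} (h : w.length = k) :
    ∃ u : Fin k → X, w = List.ofFn u := by
  subst h
  exact ⟨w.get, (List.ofFn_get w).symm⟩

theorem weight_ofFn (deg : X → ℕ+) {k : ℕ} (u : Fin k → X) :
    weight deg (List.ofFn u) = ∑ i, (deg (u i) : ℕ) := by
  simp [weight, List.map_ofFn, List.sum_ofFn]

theorem gradedPermComponent_apply_of_ne (deg : X → ℕ+) {n : ℕ} {f : Module.End ℚ (Sh X)}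
    (hf : f ∈ gradedPermComponent deg n) {w : List X} (hw : weight deg w ≠ n) :
    f (word w) = 0 := by
  have : gradedPermComponent deg n ≤ LinearMap.ker (LinearMap.applyₗ (R := ℚ) (M₂ := Sh X) (word w)) := by
    refine Submodule.span_le.mpr ?_
    rintro _ ⟨k, σ, d, hd, rfl⟩
    by_cases hk : w.length = k
    · obtain ⟨u, rfl⟩ := exists_eq_ofFn hk
      have : ¬ ∀ i, deg (u (σ i)) = d i := fun h => hw (by
        rw [weight_ofFn, ← hd, ← Equiv.sum_comp σ]
        simp [h])
      rw [SetLike.mem_coe, LinearMap.mem_ker, LinearMap.applyₗ_apply_apply, gradedPermEnd_ofFn,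
        if_neg this]
    · exact gradedPermEnd_of_length_ne deg σ d hk
  exact this hf

/-- The rearrangements of a word without repetitions come from permutations of positions. -/
theorem exists_perm_of_perm_ofFn {k : ℕ} {u : Fin k → X} (hu : Function.Injective u)
    {v : List X} (hv : v.Perm (List.ofFn u)) :
    ∃ σ : Equiv.Perm (Fin k), v = List.ofFn (u ∘ σ) := by
  have hk : v.length = k := by simpa using hv.length_eq
  subst hk
  have hmem : ∀ i : Fin v.length, ∃ j, u j = v.get i := fun i =>
    List.mem_ofFn.mp (hv.subset (List.get_mem v i))
  choose s hs using hmem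
  have hinj : Function.Injective s := fun i j hij => by
    have hnd : v.Nodup := hv.nodup_iff.mpr (List.nodup_ofFn.mpr hu)
    exact List.nodup_iff_injective_get.mp hnd (by rw [← hs, ← hs, hij])
  refine ⟨Equiv.ofBijective s (Finite.injective_iff_bijective.mp hinj), ?_⟩
  conv_lhs => rw [← List.ofFn_get v]
  exact congrArg List.ofFn (funext fun i => (hs i).symm)

theorem exists_injective_deg {deg : X → ℕ+} (hX : ∀ n : ℕ+, {x : X | deg x = n}.Infinite)
    {k : ℕ} (c : Fin k → ℕ+) :
    ∃ u : Fin k → X, Function.Injective u ∧ ∀ i, deg (u i) = c i := by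
  let e (n : ℕ+) : ℕ ↪ {x : X | deg x = n} := (hX n).natEmbedding
  -- Position `i` takes the letter number `i` of its own weight class, so equal letters force equal
  -- weights and then equal positions.
  refine ⟨fun i => e (c i) i, fun i j hij => ?_, fun i => (e (c i) i).2⟩
  have hc : c i = c j := by
    rw [← (e (c i) i).2, ← (e (c j) j).2]
    exact congrArg deg hij
  have key : ∀ n, n = c j → (e n i : X) = e (c j) j → (i : ℕ) = j := by
    rintro _ rfl h
    exact (e (c j)).injective (Subtype.ext h)
  exact Fin.ext (key _ hc hij)

/-- The coefficients are read off on one word of distinct letters; every word with the same sequence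
of weights arises from it by a substitution. -/
theorem IsGradedNatural.exists_sum {deg : X → ℕ+}
    (hX : ∀ n : ℕ+, {x : X | deg x = n}.Infinite) {n : ℕ} {f : Module.End ℚ (Sh X)}
    (hf : IsGradedNatural deg n f) {k : ℕ} (c : Fin k → ℕ+) :
    ∃ a : Equiv.Perm (Fin k) → ℚ, ∀ w : Fin k → X, (∀ i, deg (w i) = c i) →
      f (word (List.ofFn w)) = ∑ σ, a σ • word (List.ofFn (w ∘ σ)) := by
  obtain ⟨u, hu, huc⟩ := exists_injective_deg hX c
  have hmem : f (word (List.ofFn u)) ∈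
      Submodule.span ℚ (Set.range fun σ : Equiv.Perm (Fin k) => word (List.ofFn (u ∘ σ))) := by
    refine Submodule.span_mono ?_ (hf.mem_permSpan _)
    rintro _ ⟨v, hv, rfl⟩
    obtain ⟨σ, rfl⟩ := exists_perm_of_perm_ofFn hu hv
    exact ⟨σ, rfl⟩
  obtain ⟨a, ha⟩ := (Submodule.mem_span_range_iff_exists_fun ℚ).mp hmem
  refine ⟨a, fun w hw => ?_⟩
  -- Sends `u i` to `w i`, which is well defined as `u` is injective, and fixes all other letters.
  let φ : X → X := Function.extend u w id
  have hφu : φ ∘ u = w := Function.extend_comp hu _ _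
  have hφ : ∀ x, deg (φ x) = deg x := fun x => by
    by_cases hx : ∃ i, u i = x
    · obtain ⟨i, rfl⟩ := hx
      rw [show φ (u i) = w i from congrFun hφu i, hw, huc]
    · rw [show φ x = x from Function.extend_apply' _ _ _ hx]
  have := hf.map_comm φ hφ (List.ofFn u)
  rw [List.map_ofFn, hφu, ← ha] at this
  rw [this, map_sum]
  refine Finset.sum_congr rfl fun σ _ => ?_
  rw [map_smul, mapWord_word, List.map_ofFn, ← Function.comp_assoc, hφu]

/-- The projection on the words whose letters have prescribed weights. -/
def degProj (deg : X → ℕ+) (D : List ℕ+) : Module.End ℚ (Sh X) :=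
  Finsupp.linearCombination ℚ fun w : List X => if w.map deg = D then word w else 0

theorem degProj_word (deg : X → ℕ+) (D : List ℕ+) (w : List X) :
    degProj deg D (word w) = if w.map deg = D then word w else 0 := by
  simp [degProj]

theorem IsGradedNatural.comp_degProj_mem {deg : X → ℕ+}
    (hX : ∀ n : ℕ+, {x : X | deg x = n}.Infinite) {n : ℕ} {f : Module.End ℚ (Sh X)}
    (hf : IsGradedNatural deg n f) {k : ℕ} (c : Fin k → ℕ+) (hc : ∑ i, (c i : ℕ) = n) :
    f ∘ₗ degProj deg (List.ofFn c) ∈ gradedPermComponent deg n := by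
  obtain ⟨a, ha⟩ := hf.exists_sum hX c
  -- `(σ, d)` tests weights in the permuted order, so `d = c ∘ σ` selects exactly the words with
  -- weight sequence `c`.
  have : f ∘ₗ degProj deg (List.ofFn c) = ∑ σ, a σ • gradedPermEnd deg σ (c ∘ σ) := by
    refine linearMap_ext_word fun w => ?_
    by_cases hk : w.length = k
    · obtain ⟨u, rfl⟩ := exists_eq_ofFn hk
      have h : ∀ σ : Equiv.Perm (Fin k),
          (∀ i, deg (u (σ i)) = c (σ i)) ↔ ∀ i, deg (u i) = c i := fun σ =>
        σ.forall_congr_right (q := fun i => deg (u i) = c i)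
      simp only [LinearMap.comp_apply, degProj_word, LinearMap.sum_apply, LinearMap.smul_apply,
        gradedPermEnd_ofFn, Function.comp_apply, h, List.map_ofFn, List.ofFn_inj, funext_iff]
      split_ifs with huc
      · exact ha u huc
      · simp
    · have : w.map deg ≠ List.ofFn c := fun h => hk (by simpa using congrArg List.length h)
      simp [degProj_word, this, gradedPermEnd_of_length_ne deg _ _ hk]
  rw [this]
  refine sum_mem fun σ _ => Submodule.smul_mem _ _ (Submodule.subset_span ⟨k, σ, _, ?_, rfl⟩)
  rw [← hc]
  exact Equiv.sum_comp σ fun i => (c i : ℕ)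

theorem finite_degrees (n : ℕ) : {D : List ℕ+ | (D.map PNat.val).sum = n}.Finite := by
  let g (D : {D : List ℕ+ | (D.map PNat.val).sum = n}) : Composition n :=
    ⟨D.1.map PNat.val, by simp, D.2⟩
  have hg : Function.Injective g := fun D E h =>
    Subtype.ext (List.map_injective_iff.mpr PNat.coe_injective (congrArg Composition.blocks h))
  exact Set.finite_coe_iff.mp (Finite.of_injective g hg)

/-- Such an `f` is the sum of its restrictions to the finitely many weight sequences with sum `n`.
-/
theorem IsGradedNatural.mem_gradedPermComponent {deg : X → ℕ+}
    (hX : ∀ n : ℕ+, {x : X | deg x = n}.Infinite) {n : ℕ} {f : Module.End ℚ (Sh X)}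
    (hf : IsGradedNatural deg n f) : f ∈ gradedPermComponent deg n := by
  have : f = ∑ D ∈ (finite_degrees n).toFinset, f ∘ₗ degProj deg D := by
    refine linearMap_ext_word fun w => ?_
    have hw : w.map deg ∈ (finite_degrees n).toFinset ↔ weight deg w = n := by
      simp [weight, Function.comp_def]
    simp only [LinearMap.sum_apply, LinearMap.comp_apply, degProj_word]
    by_cases h : weight deg w = n
    · rw [Finset.sum_eq_single_of_mem _ (hw.mpr h) fun D _ hD => by simp [hD.symm]]
      simp
    · rw [hf.apply_of_ne w h]
      refine (Finset.sum_eq_zero fun D hD => ?_).symm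
      rw [if_neg (by rintro rfl; exact h (hw.mp hD)), map_zero]
  rw [this]
  refine sum_mem fun D hD => ?_
  rw [← List.ofFn_get D]
  refine hf.comp_degProj_mem hX _ ?_
  have hs : (D.map PNat.val).sum = n := by simpa using hD
  rw [← hs, ← List.sum_ofFn]
  congr 1
  conv_rhs => rw [← List.ofFn_get D, List.map_ofFn]
  rfl

theorem treeEnd_mem_gradedPermComponent {deg : X → ℕ+}
    (hX : ∀ n : ℕ+, {x : X | deg x = n}.Infinite) (t : BinaryTree ℕ) :
    treeEnd deg t ∈ gradedPermComponent deg (treeWeight t) :=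
  (isGradedNatural_treeEnd deg t).mem_gradedPermComponent hX

/-! ### Linear independence -/

/-- The linear map that removes a given first letter from words. -/
def leftDeriv (x : X) : Sh X →ₗ[ℚ] Sh X := Finsupp.lcomapDomain (List.cons x) List.cons_injective

theorem leftDeriv_apply (x : X) (a : Sh X) (v : List X) : leftDeriv x a v = a (x :: v) := rfl

@[simp] theorem leftDeriv_nil (x : X) : leftDeriv x (word []) = 0 := by
  ext v; simp [leftDeriv_apply]

theorem leftDeriv_consLetter (x : X) (a : Sh X) : leftDeriv x (consLetter x a) = a := by
  ext v; rw [leftDeriv_apply, consLetter_apply_cons]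

theorem leftDeriv_consLetter_of_ne {x y : X} (h : x ≠ y) (a : Sh X) :
    leftDeriv x (consLetter y a) = 0 := by
  ext v; rw [leftDeriv_apply, consLetter_apply_cons_of_ne h]; rfl

theorem leftDeriv_word_of_ne {x y : X} (h : x ≠ y) (w : List X) :
    leftDeriv x (word (y :: w)) = 0 := by
  rw [← consLetter_word, leftDeriv_consLetter_of_ne h]

theorem leftDeriv_word_cons (x : X) (w : List X) : leftDeriv x (word (x :: w)) = word w := by
  rw [← consLetter_word, leftDeriv_consLetter]

theorem leftDeriv_halfShuffle (x : X) (a b : Sh X) :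
    leftDeriv x (halfShuffle a b) = shuffle (leftDeriv x a) b := by
  have : leftDeriv x ∘ₗ halfShuffle.flip b = shuffle.flip b ∘ₗ leftDeriv x := by
    refine linearMap_ext_word ?_
    rintro (_ | ⟨y, u⟩)
    · simp
    · by_cases h : x = y
      · subst h
        simp only [← consLetter_word, LinearMap.comp_apply, LinearMap.flip_apply,
          halfShuffle_consLetter, leftDeriv_consLetter]
      · simp only [← consLetter_word, LinearMap.comp_apply, LinearMap.flip_apply,
          halfShuffle_consLetter, leftDeriv_consLetter_of_ne h, map_zero]
  exact LinearMap.congr_fun this a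

theorem splitSum_eq_single {M : Type*} [AddCommMonoid M] {Φ : List X → List X → M}
    (a b : List X) (h : ∀ a' b', a' ++ b' = a ++ b → a' ≠ a → Φ a' b' = 0) :
    splitSum Φ (a ++ b) = Φ a b := by
  rw [splitSum, Finset.sum_eq_single_of_mem a.length (by simp)]
  · simp
  · intro k hk hne
    refine h _ _ (List.take_append_drop k _) fun he => hne ?_
    have := congrArg List.length he
    simp only [Finset.mem_range, List.length_append, List.length_take] at hk this
    omega

theorem treeEnd_node_word (deg : X → ℕ+) (a : ℕ) (l r : BinaryTree ℕ) (w : List X) :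
    treeEnd deg (.node a l r) (word w) =
      splitSum (fun u v => halfShuffle (splitSum (fun p q => halfShuffle
        (proj deg (a + 1) (word p)) (treeEnd deg r (word q))) v) (treeEnd deg l (word u))) w := by
  rw [treeEnd, conv_apply_word]
  simp only [conv_apply_word, LinearMap.flip_apply]

theorem proj_succ_nil (deg : X → ℕ+) (a : ℕ) : proj deg (a + 1) (word []) = 0 := by
  simp [proj_word]

/-- Each node needs a nonempty block of the word, as `p_{a+1}` kills the empty word. -/
theorem treeEnd_eq_zero_of_length_lt (deg : X → ℕ+) {t : BinaryTree ℕ} {w : List X}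
    (h : w.length < t.numNodes) : treeEnd deg t (word w) = 0 := by
  induction t generalizing w with
  | nil => simp at h
  | node a l r hl hr =>
    simp only [BinaryTree.numNodes] at h
    rw [treeEnd_node_word]
    refine splitSum_eq_zero fun u v huv => ?_
    by_cases hu : u.length < l.numNodes
    · simp [hl hu]
    rw [splitSum_eq_zero, map_zero, LinearMap.zero_apply]
    rintro (_ | ⟨y, p⟩) q hpq
    · simp [proj_succ_nil]
    · rw [hr, map_zero]
      subst hpq huv
      simp at h
      omega

/-- The first letter of the output is the first letter of the block given to the root, so this block
starts at the only `x` and `l` receives `A`. If `A` is long enough for `l`, the length bound makes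
`B` no longer than `r` requires, so a block larger than `[x]` would starve `r`. -/
theorem leftDeriv_treeEnd_node (deg : X → ℕ+) (a : ℕ) (l r : BinaryTree ℕ) {x : X}
    {A B : List X} (hA : x ∉ A) (hB : x ∉ B)
    (hlen : A.length + B.length ≤ l.numNodes + r.numNodes) :
    leftDeriv x (treeEnd deg (.node a l r) (word (A ++ x :: B))) =
      if (deg x : ℕ) = a + 1 then
        shuffle (treeEnd deg r (word B)) (treeEnd deg l (word A)) else 0 := by
  rw [treeEnd_node_word, map_splitSum]
  have hinner : ∀ v, leftDeriv x (splitSum (fun p q => halfShuffle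
      (proj deg (a + 1) (word p)) (treeEnd deg r (word q))) v) = splitSum (fun p q => shuffle
      (leftDeriv x (proj deg (a + 1) (word p))) (treeEnd deg r (word q))) v := fun v => by
    rw [map_splitSum]
    simp only [leftDeriv_halfShuffle]
  simp only [leftDeriv_halfShuffle, hinner]
  have hproj : ∀ p, leftDeriv x (proj deg (a + 1) (word p)) ≠ 0 → ∃ p', p = x :: p' := by
    rintro (_ | ⟨y, p⟩) hp
    · simp [proj_succ_nil] at hp
    · by_cases h : x = y
      · exact ⟨p, by rw [h]⟩
      · refine absurd ?_ hp
        rw [proj_word]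
        split_ifs
        · exact leftDeriv_word_of_ne h p
        · exact map_zero _
  rw [splitSum_eq_single]
  · by_cases hl : A.length < l.numNodes
    · simp [treeEnd_eq_zero_of_length_lt deg hl]
    rw [show x :: B = [x] ++ B from rfl, splitSum_eq_single]
    · rw [proj_word]
      simp only [weight_cons, weight_nil, add_zero]
      split_ifs with hx
      · rw [leftDeriv_word_cons, shuffle_nil_left]
      · simp
    · intro p q hpq hp
      by_cases h0 : leftDeriv x (proj deg (a + 1) (word p)) = 0
      · simp [h0]
      obtain ⟨p', rfl⟩ := hproj p h0
      have hp' : p' ≠ [] := by rintro rfl; exact hp rfl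
      have := List.length_pos_iff.mpr hp'
      have hBl := congrArg List.length hpq
      simp at hBl
      rw [treeEnd_eq_zero_of_length_lt deg (w := q) (by omega), map_zero]
  · intro u v huv hu
    rw [splitSum_eq_zero, map_zero, LinearMap.zero_apply]
    intro p q hpq
    by_cases h0 : leftDeriv x (proj deg (a + 1) (word p)) = 0
    · simp [h0]
    obtain ⟨p', rfl⟩ := hproj p h0
    subst hpq
    exact absurd ((List.append_cons_inj_of_notMem hA hB).mp huv.symm).1.symm hu

/-- The prefix `u` can only use letters of `p`, and no letter of `p` may be left over for `v`. -/
theorem shuffle_apply_append_word {p q u v : List X} (h1 : ∀ x ∈ u, x ∉ q)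
    (h2 : ∀ x ∈ p, x ∉ v) :
    shuffle (word q) (word p) (u ++ v) = word p u * word q v := by
  induction u generalizing p with
  | nil =>
    rcases p with _ | ⟨z, p⟩
    · simp
    rcases q with _ | ⟨y, q⟩
    · have : z :: p ≠ v := by rintro rfl; exact h2 z (by simp) (by simp)
      simp [this]
    · have hz : z ∉ v := h2 z (by simp)
      have hm := shuffle_word_mem_permSpan (y :: q) (z :: p)
      have hle : permSpan (y :: q ++ z :: p) ≤ LinearMap.ker (Finsupp.lapply v : Sh X →ₗ[ℚ] ℚ) := by
        refine Submodule.span_le.mpr ?_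
        rintro _ ⟨w, hw, rfl⟩
        have : w ≠ v := by
          rintro rfl
          exact hz (hw.symm.subset (by simp))
        simp [this]
      have := hle hm
      simp only [LinearMap.mem_ker, Finsupp.lapply_apply] at this
      simp [this]
  | cons x u ih =>
    have hx : x ∉ q := h1 x (by simp)
    have hq : leftDeriv x (word q) = 0 := by
      rcases q with _ | ⟨y, q⟩
      · simp
      · exact leftDeriv_word_of_ne (fun h => hx (by simp [h])) q
    rw [List.cons_append, ← leftDeriv_apply, shuffle_eq_add, map_add, map_add, map_smul,
      leftDeriv_halfShuffle, leftDeriv_halfShuffle, hq, leftDeriv_nil, smul_zero, map_zero,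
      LinearMap.zero_apply, zero_add, add_zero, ← leftDeriv_apply x (word p)]
    rcases p with _ | ⟨z, p⟩
    · simp
    · by_cases hxz : x = z
      · subst hxz
        rw [leftDeriv_word_cons, shuffle_comm]
        exact ih (fun y hy => h1 y (by simp [hy])) fun y hy => h2 y (by simp [hy])
      · simp [leftDeriv_word_of_ne hxz]

theorem shuffle_apply_append {A B u v : List X} (hAB : A.Disjoint B) (hu : u.Perm A)
    (hv : v.Perm B) {a b : Sh X} (ha : a ∈ permSpan A) (hb : b ∈ permSpan B) :
    shuffle b a (u ++ v) = a u * b v := by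
  -- The difference of the two sides as a bilinear form; it vanishes once it vanishes on words.
  let D : Sh X →ₗ[ℚ] Sh X →ₗ[ℚ] ℚ := shuffle.flip.compr₂ (Finsupp.lapply (u ++ v)) -
    (LinearMap.mul ℚ ℚ).compl₁₂ (Finsupp.lapply u) (Finsupp.lapply v)
  have : D a b ∈ (⊥ : Submodule ℚ ℚ) := by
    refine LinearMap.BilinMap.apply_apply_mem_of_mem_span _ _ _ D ?_ a b ha hb
    rintro _ ⟨p, hp, rfl⟩ _ ⟨q, hq, rfl⟩
    have := shuffle_apply_append_word (p := p) (q := q) (u := u) (v := v)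
      (fun x hx hxq => hAB (hu.subset hx) (hq.subset hxq))
      (fun x hx hxv => hAB (hp.subset hx) (hv.subset hxv))
    simpa [D, sub_eq_zero] using this
  simpa [D, sub_eq_zero] using this

/-- The labels of a binary tree, in symmetric order. -/
def inorder {α : Type*} : BinaryTree α → List α
  | .nil => []
  | .node a l r => inorder l ++ a :: inorder r

/-- The labels of a binary tree, with the root first. -/
def preorder {α : Type*} : BinaryTree α → List α
  | .nil => []
  | .node a l r => a :: (preorder l ++ preorder r)

theorem preorder_perm_inorder {α : Type*} (t : BinaryTree α) : (preorder t).Perm (inorder t) := by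
  induction t with
  | nil => rfl
  | node a l r hl hr => exact ((hl.append hr).cons a).trans List.perm_middle.symm

theorem length_inorder {α : Type*} (t : BinaryTree α) : (inorder t).length = t.numNodes := by
  induction t with
  | nil => rfl
  | node a l r hl hr => simp [inorder, hl, hr]; omega

theorem numNodes_map {α β : Type*} (f : α → β) (t : BinaryTree α) :
    (t.map f).numNodes = t.numNodes := by
  induction t with
  | nil => rfl
  | node a l r hl hr => simp [BinaryTree.map, hl, hr]

/-- The tree of labels that a tree of letters stands for. -/
abbrev labelTree (deg : X → ℕ+) (τ : BinaryTree X) : BinaryTree ℕ :=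
  τ.map fun x => (deg x).natPred

open Classical in
-- The preorder word starts with the root, and the inorder word splits there into those of the
-- subtrees. Removing the root letter leaves a shuffle of words in disjoint letters, whose
-- coefficient is the product of those of the subtrees.
theorem treeEnd_inorder_preorder (deg : X → ℕ+) {τ : BinaryTree X} (hτ : (inorder τ).Nodup)
    {t : BinaryTree ℕ} (h : τ.numNodes ≤ t.numNodes) :
    treeEnd deg t (word (inorder τ)) (preorder τ) = if t = labelTree deg τ then 1 else 0 := by
  induction τ generalizing t with
  | nil =>
    rcases t with _ | ⟨a, l, r⟩
    · simp [inorder, preorder, treeEnd, BinaryTree.map]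
    · rw [preorder, treeEnd_node_apply_nil, if_neg (by simp [BinaryTree.map])]
  | node x τl τr ihl ihr =>
    rcases t with _ | ⟨a, l, r⟩
    · simp at h
    simp only [BinaryTree.numNodes] at h
    rw [inorder, List.nodup_append'] at hτ
    obtain ⟨hl, hr, hd⟩ := hτ
    rw [List.nodup_cons] at hr
    obtain ⟨hxr, hr⟩ := hr
    rw [List.disjoint_cons_right] at hd
    rw [inorder, preorder, ← leftDeriv_apply,
      leftDeriv_treeEnd_node deg a l r hd.1 hxr (by rw [length_inorder, length_inorder]; omega)]
    have hne : ∀ {s : BinaryTree ℕ} {σ : BinaryTree X}, σ.numNodes < s.numNodes →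
        s ≠ labelTree deg σ := by
      rintro s σ hs rfl
      rw [numNodes_map] at hs
      exact hs.false
    by_cases hx : (deg x : ℕ) = a + 1
    · have hxa : a = (deg x).natPred := by
        have := PNat.natPred_add_one (deg x)
        omega
      rw [if_pos hx]
      simp only [BinaryTree.map, BinaryTree.node.injEq, hxa, true_and]
      by_cases h1 : τl.numNodes < l.numNodes
      · rw [treeEnd_eq_zero_of_length_lt deg (w := inorder τl) (by rwa [length_inorder]),
          map_zero, if_neg (fun h => hne h1 h.1)]
        rfl
      by_cases h2 : τr.numNodes < r.numNodes
      · rw [treeEnd_eq_zero_of_length_lt deg (w := inorder τr) (by rwa [length_inorder]),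
          map_zero, if_neg (fun h => hne h2 h.2)]
        rfl
      -- With neither subtree of `t` larger, the bound on the totals forces equal node counts on
      -- each side, as the induction hypotheses require.
      rw [shuffle_apply_append hd.2 (preorder_perm_inorder τl) (preorder_perm_inorder τr)
        ((isGradedNatural_treeEnd deg l).mem_permSpan _)
        ((isGradedNatural_treeEnd deg r).mem_permSpan _),
        ihl hl (by omega), ihr hr (by omega), ite_zero_mul_ite_zero, one_mul]
    · rw [if_neg hx, if_neg]
      · rfl
      · simp only [BinaryTree.map, BinaryTree.node.injEq]
        rintro ⟨rfl, -⟩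
        exact hx (PNat.natPred_add_one (deg x)).symm

open Classical in
-- The list `A` of forbidden letters keeps the letters chosen for the root and the two subtrees
-- apart in the induction.
theorem exists_labelTree_eq {deg : X → ℕ+} (hX : ∀ n : ℕ+, {x : X | deg x = n}.Infinite)
    (t : BinaryTree ℕ) (A : List X) :
    ∃ τ : BinaryTree X, labelTree deg τ = t ∧ (inorder τ).Nodup ∧ (inorder τ).Disjoint A := by
  induction t generalizing A with
  | nil => exact ⟨.nil, rfl, by simp [inorder], by simp [inorder]⟩
  | node a l r hl hr =>
    obtain ⟨τl, rfl, hl1, hl2⟩ := hl A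
    obtain ⟨x, hx, hxA⟩ := (hX a.succPNat).exists_notMem_finset (A ++ inorder τl).toFinset
    obtain ⟨τr, rfl, hr1, hr2⟩ := hr (x :: (A ++ inorder τl))
    simp only [List.disjoint_cons_right, List.disjoint_append_right, List.mem_toFinset,
      List.mem_append, not_or] at hr2 hxA
    refine ⟨.node x τl τr, ?_, ?_, ?_⟩
    · simp only [Set.mem_ofPred_eq] at hx
      simp [BinaryTree.map, hx]
    · rw [inorder, List.nodup_append', List.nodup_cons, List.disjoint_cons_right]
      exact ⟨hl1, ⟨hr2.1, hr1⟩, hxA.2, hr2.2.2.symm⟩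
    · rw [inorder, List.disjoint_append_left, List.disjoint_cons_left]
      exact ⟨hl2, hxA.1, hr2.2.1⟩

theorem linearIndependent_treeEnd {deg : X → ℕ+}
    (hX : ∀ n : ℕ+, {x : X | deg x = n}.Infinite) : LinearIndependent ℚ (treeEnd deg) := by
  rw [linearIndependent_iff]
  intro c hc
  by_contra hne
  -- With fewest nodes in the support, `t` satisfies the size bound against every other tree in the
  -- relation, so the test coefficient isolates `c t`.
  obtain ⟨t, ht, hmin⟩ := c.support.exists_min_image BinaryTree.numNodes
    (Finsupp.support_nonempty_iff.mpr hne)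
  obtain ⟨τ, rfl, hτ, -⟩ := exists_labelTree_eq hX t []
  have h := congrArg (fun f : Module.End ℚ (Sh X) => f (word (inorder τ)) (preorder τ)) hc
  simp only [Finsupp.linearCombination_apply, Finsupp.sum, LinearMap.sum_apply,
    LinearMap.smul_apply, Finsupp.finsetSum_apply, Finsupp.smul_apply, LinearMap.zero_apply,
    Finsupp.zero_apply] at h
  rw [Finset.sum_eq_single_of_mem _ ht] at h
  · rw [treeEnd_inorder_preorder deg hτ (numNodes_map _ _).ge, if_pos rfl, smul_eq_mul,
      mul_one] at h
    exact Finsupp.mem_support_iff.mp ht h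
  · intro s hs hst
    rw [treeEnd_inorder_preorder deg hτ ((numNodes_map _ _).symm.trans_le (hmin s hs)),
      if_neg hst, smul_zero]

/-! ### The homogeneous components -/

theorem comp_proj_of_mem {deg : X → ℕ+} {n : ℕ} {f : Module.End ℚ (Sh X)}
    (hf : f ∈ gradedPermComponent deg n) : f ∘ₗ proj deg n = f :=
  linearMap_ext_word fun w => by
    rw [LinearMap.comp_apply, proj_word]
    split_ifs with h
    · rfl
    · rw [map_zero, gradedPermComponent_apply_of_ne deg hf h]

theorem comp_proj_of_mem_of_ne {deg : X → ℕ+} {m n : ℕ} (hmn : m ≠ n)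
    {f : Module.End ℚ (Sh X)} (hf : f ∈ gradedPermComponent deg m) : f ∘ₗ proj deg n = 0 :=
  linearMap_ext_word fun w => by
    rw [LinearMap.comp_apply, proj_word]
    split_ifs with h
    · exact gradedPermComponent_apply_of_ne deg hf (h.trans_ne hmn.symm)
    · rw [map_zero, LinearMap.zero_apply]

theorem treeEnd_mem_descdComponent {deg : X → ℕ+}
    (hX : ∀ n : ℕ+, {x : X | deg x = n}.Infinite) (t : BinaryTree ℕ) :
    treeEnd deg t ∈ descdComponent deg (treeWeight t) :=
  ⟨treeEnd_mem_descd deg t, treeEnd_mem_gradedPermComponent hX t⟩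

/-- Precomposition with `p_n` fixes degree `n` and kills every tree of another weight. -/
theorem descdComponent_eq_span {deg : X → ℕ+}
    (hX : ∀ n : ℕ+, {x : X | deg x = n}.Infinite) (n : ℕ) :
    descdComponent deg n = Submodule.span ℚ (treeEnd deg '' {t | treeWeight t = n}) := by
  refine le_antisymm ?_ (Submodule.span_le.mpr ?_)
  · rintro f ⟨hf, hfn⟩
    have hle : treeSpan deg ≤ (Submodule.span ℚ (treeEnd deg '' {t | treeWeight t = n})).comap
        (LinearMap.lcomp ℚ (Sh X) (proj deg n)) := by
      refine Submodule.span_le.mpr ?_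
      rintro _ ⟨t, rfl⟩
      rw [SetLike.mem_coe, Submodule.mem_comap, LinearMap.lcomp_apply']
      have ht := treeEnd_mem_gradedPermComponent hX t
      by_cases h : treeWeight t = n
      · rw [← h, comp_proj_of_mem ht]
        exact Submodule.subset_span ⟨t, rfl, rfl⟩
      · rw [comp_proj_of_mem_of_ne h ht]
        exact zero_mem _
    rw [SetLike.mem_coe, descd_eq_treeSpan] at hf
    have := hle hf
    rwa [Submodule.mem_comap, LinearMap.lcomp_apply', comp_proj_of_mem hfn] at this
  · rintro _ ⟨t, rfl, rfl⟩
    exact treeEnd_mem_descdComponent hX t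

theorem isInternal_descdComponent {deg : X → ℕ+}
    (hX : ∀ n : ℕ+, {x : X | deg x = n}.Infinite) :
    DirectSum.IsInternal (fun n : ℕ => (descdComponent deg n).submoduleOf (descd deg)) := by
  refine (DirectSum.isInternal_submodule_iff_iSupIndep_and_iSup_eq_top (R := ℚ)
    (M := descd deg) fun n : ℕ => (descdComponent deg n).submoduleOf (descd deg)).mpr ⟨?_, ?_⟩
  · intro n
    rw [Submodule.disjoint_def]
    intro f hf hf'
    have hle : ⨆ m, ⨆ (_ : m ≠ n), (descdComponent deg m).submoduleOf (descd deg) ≤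
        LinearMap.ker (LinearMap.lcomp ℚ (Sh X) (proj deg n) ∘ₗ (descd deg).subtype) := by
      refine iSup₂_le fun m hm g hg => ?_
      exact comp_proj_of_mem_of_ne hm hg.2
    have h0 : (f : Module.End ℚ (Sh X)) ∘ₗ proj deg n = 0 := hle hf'
    exact Subtype.ext ((comp_proj_of_mem hf.2).symm.trans h0)
  · have key : treeSpan deg ≤ (⨆ n, (descdComponent deg n).submoduleOf (descd deg)).map
        (descd deg).subtype := by
      refine Submodule.span_le.mpr ?_
      rintro _ ⟨t, rfl⟩
      exact ⟨⟨treeEnd deg t, treeEnd_mem_descd deg t⟩, Submodule.mem_iSup_of_mem (treeWeight t)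
        (treeEnd_mem_descdComponent hX t), rfl⟩
    rw [← descd_eq_treeSpan] at key
    rw [eq_top_iff]
    rintro f -
    obtain ⟨g, hg, hgf⟩ := key f.2
    rwa [← Subtype.ext hgf]

/-! ### Counting labelled trees -/

theorem finite_treeWeight_le (n : ℕ) : {t | treeWeight t ≤ n}.Finite := by
  induction n with
  | zero =>
    refine (Set.finite_singleton BinaryTree.nil).subset ?_
    rintro (_ | ⟨a, l, r⟩) ht
    · rfl
    · simp [treeWeight] at ht
  | succ n ih =>
    refine ((Set.finite_singleton BinaryTree.nil).union
      (((Set.finite_Iic n).prod (ih.prod ih)).image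
        fun p => BinaryTree.node p.1 p.2.1 p.2.2)).subset ?_
    rintro (_ | ⟨a, l, r⟩) ht
    · exact Or.inl rfl
    · simp only [Set.mem_ofPred_eq, treeWeight] at ht
      refine Or.inr ⟨(a, l, r), ⟨?_, ?_, ?_⟩, rfl⟩ <;>
        simp only [Set.mem_Iic, Set.mem_ofPred_eq] <;> omega

/-- The labelled binary trees of weight `n`. -/
def treesOfWeight (n : ℕ) : Finset (BinaryTree ℕ) :=
  ((finite_treeWeight_le n).subset (t := {t | treeWeight t = n}) fun _ h => le_of_eq h).toFinset

@[simp] theorem mem_treesOfWeight {n : ℕ} {t : BinaryTree ℕ} :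
    t ∈ treesOfWeight n ↔ treeWeight t = n := by
  simp [treesOfWeight]

theorem card_treesOfWeight_zero : (treesOfWeight 0).card = 1 := by
  rw [Finset.card_eq_one]
  refine ⟨.nil, Finset.ext ?_⟩
  rintro (_ | ⟨a, l, r⟩) <;> simp [treeWeight]

/-- Cut at the root: a label `a` has weight `a + 1`, so `a` and the weights of the two subtrees add
up to `n`. -/
theorem card_treesOfWeight_succ (n : ℕ) : (treesOfWeight (n + 1)).card =
    ∑ p ∈ Finset.HasAntidiagonal.antidiagonal n, ∑ q ∈ Finset.HasAntidiagonal.antidiagonal p.2,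
      (treesOfWeight q.1).card * (treesOfWeight q.2).card := by
  simp only [← Finset.card_product, ← Finset.card_sigma]
  symm
  refine Finset.card_nbij (fun s => .node s.1.1 s.2.2.1 s.2.2.2) ?_ ?_ ?_
  · rintro ⟨⟨a, m⟩, ⟨i, j⟩, l, r⟩ h
    simp only [Finset.coe_sigma, Set.mem_sigma_iff, Finset.mem_coe,
      Finset.HasAntidiagonal.mem_antidiagonal, Finset.mem_product, mem_treesOfWeight] at h
    simp only [Finset.mem_coe, mem_treesOfWeight, treeWeight]
    omega
  · rintro ⟨⟨a, m⟩, ⟨i, j⟩, l, r⟩ h ⟨⟨a', m'⟩, ⟨i', j'⟩, l', r'⟩ h' he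
    simp only [Finset.coe_sigma, Set.mem_sigma_iff, Finset.mem_coe,
      Finset.HasAntidiagonal.mem_antidiagonal, Finset.mem_product, mem_treesOfWeight] at h h'
    simp only [BinaryTree.node.injEq] at he
    obtain ⟨rfl, rfl, rfl⟩ := he
    obtain ⟨h1, h2, rfl, rfl⟩ := h
    obtain ⟨h1', h2', rfl, rfl⟩ := h'
    subst h2 h2'
    rfl
  · rintro (_ | ⟨a, l, r⟩) h
    · simp [treeWeight] at h
    · simp only [Finset.mem_coe, mem_treesOfWeight, treeWeight] at h
      refine ⟨⟨(a, treeWeight l + treeWeight r), (treeWeight l, treeWeight r), l, r⟩, ?_, rfl⟩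
      simp
      omega

/-! ### Dimensions and the generating series. -/

theorem finite_descdComponent {deg : X → ℕ+}
    (hX : ∀ n : ℕ+, {x : X | deg x = n}.Infinite) (n : ℕ) :
    Module.Finite ℚ (descdComponent deg n) := by
  rw [descdComponent_eq_span hX]
  refine Module.Finite.span_of_finite ℚ (Set.Finite.image _ ?_)
  exact (finite_treeWeight_le n).subset fun _ h => le_of_eq h

theorem finrank_descdComponent {deg : X → ℕ+}
    (hX : ∀ n : ℕ+, {x : X | deg x = n}.Infinite) (n : ℕ) :
    Module.finrank ℚ (descdComponent deg n) = (treesOfWeight n).card := by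
  have h : descdComponent deg n =
      Submodule.span ℚ (Set.range fun t : treesOfWeight n => treeEnd deg t) := by
    rw [descdComponent_eq_span hX]
    congr 1
    ext f
    simp
  have hli : LinearIndependent ℚ fun t : treesOfWeight n => treeEnd deg t :=
    (linearIndependent_treeEnd hX).comp _ Subtype.val_injective
  rw [h, finrank_span_eq_card hli, Fintype.card_coe]

theorem descdSeries_eq {deg : X → ℕ+} (hX : ∀ n : ℕ+, {x : X | deg x = n}.Infinite) :
    descdSeries deg = 1 + PowerSeries.X * (1 - PowerSeries.X)⁻¹ * descdSeries deg ^ 2 := by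
  have hinv : (1 - PowerSeries.X : PowerSeries ℚ)⁻¹ = PowerSeries.mk 1 := by
    rw [PowerSeries.inv_eq_iff_mul_eq_one (by simp)]
    exact PowerSeries.mk_one_mul_one_sub_eq_one ℚ
  rw [hinv, mul_assoc]
  ext n
  rcases n with _ | n
  · simp [descdSeries, finrank_descdComponent hX, card_treesOfWeight_zero]
  · rw [map_add, PowerSeries.coeff_succ_X_mul, PowerSeries.coeff_mul]
    simp only [sq, PowerSeries.coeff_mul, PowerSeries.coeff_mk, Pi.one_apply, one_mul,
      descdSeries, finrank_descdComponent hX, card_treesOfWeight_succ]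
    simp [PowerSeries.coeff_one]

/-- The difference of the equations factors as `(A - B) * (1 - Y * (A + B))`, and the second factor
has constant term 1. -/
theorem eq_of_eq_one_add_mul_sq {A B Y : PowerSeries ℚ} (hY : PowerSeries.constantCoeff Y = 0)
    (hA : A = 1 + Y * A ^ 2) (hB : B = 1 + Y * B ^ 2) : A = B := by
  have h : (A - B) * (1 - Y * (A + B)) = 0 := by linear_combination hA - hB
  rcases mul_eq_zero.mp h with h | h
  · exact sub_eq_zero.mp h
  · simpa [hY] using congrArg PowerSeries.constantCoeff h

theorem subst_catalanSeries {Y : PowerSeries ℚ} (hY : PowerSeries.constantCoeff Y = 0) :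
    PowerSeries.subst Y (PowerSeries.map (Nat.castRingHom ℚ) PowerSeries.catalanSeries) =
      1 + Y * PowerSeries.subst Y
        (PowerSeries.map (Nat.castRingHom ℚ) PowerSeries.catalanSeries) ^ 2 := by
  have hs : PowerSeries.HasSubst Y := PowerSeries.HasSubst.of_constantCoeff_zero' hY
  have h := congrArg (PowerSeries.map (Nat.castRingHom ℚ))
    PowerSeries.catalanSeries_sq_mul_X_add_one
  rw [map_add, map_mul, map_pow, map_one, PowerSeries.map_X] at h
  have h2 := congrArg (PowerSeries.substAlgHom (R := ℚ) hs) h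
  rw [map_add, map_mul, map_pow, map_one, PowerSeries.substAlgHom_X,
    PowerSeries.coe_substAlgHom] at h2
  rw [add_comm, mul_comm]
  exact h2.symm

end GradedShuffle

end

theorem mainTheorem7 {X : Type*} (deg : X → ℕ+)
    (hX : ∀ n : ℕ+, {x : X | deg x = n}.Infinite) :
    DirectSum.IsInternal (fun n : ℕ =>
        (GradedShuffle.descdComponent deg n).submoduleOf (GradedShuffle.descd deg)) ∧
    (∀ n : ℕ, Module.Finite ℚ (GradedShuffle.descdComponent deg n)) ∧
    (∃ R : PowerSeries ℚ,
      R ^ 2 = (1 - PowerSeries.X) * (1 - 5 * PowerSeries.X) ∧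
      PowerSeries.constantCoeff R = 1 ∧
      2 * PowerSeries.X * GradedShuffle.descdSeries deg = 1 - PowerSeries.X - R) ∧
    GradedShuffle.descdSeries deg =
      PowerSeries.subst (PowerSeries.X * (1 - PowerSeries.X)⁻¹ : PowerSeries ℚ)
        (PowerSeries.map (Nat.castRingHom ℚ) PowerSeries.catalanSeries) ∧
    (List.range 10).map (fun n => Module.finrank ℚ (GradedShuffle.descdComponent deg n)) =
      [1, 1, 3, 10, 36, 137, 543, 2219, 9285, 39587] := by
  have hT := GradedShuffle.descdSeries_eq hX
  have hI : (1 - PowerSeries.X : PowerSeries ℚ) * (1 - PowerSeries.X)⁻¹ = 1 :=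
    PowerSeries.mul_inv_cancel _ (by simp)
  -- The root `R` is read off from the required linear relation; its square is then computed from
  -- the quadratic equation, cleared of the inverse of `1 - X`.
  refine ⟨GradedShuffle.isInternal_descdComponent hX, GradedShuffle.finite_descdComponent hX,
    ⟨1 - PowerSeries.X - 2 * PowerSeries.X * GradedShuffle.descdSeries deg, ?_, ?_, ?_⟩, ?_, ?_⟩
  · have h : (1 - PowerSeries.X) * GradedShuffle.descdSeries deg =
        (1 - PowerSeries.X) + PowerSeries.X * GradedShuffle.descdSeries deg ^ 2 := by
      linear_combination (1 - PowerSeries.X) * hT +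
        PowerSeries.X * GradedShuffle.descdSeries deg ^ 2 * hI
    linear_combination -4 * PowerSeries.X * h
  · simp
  · ring
  · exact GradedShuffle.eq_of_eq_one_add_mul_sq (by simp) hT
      (GradedShuffle.subst_catalanSeries (by simp))
  · simp only [GradedShuffle.finrank_descdComponent hX]
    have h0 := GradedShuffle.card_treesOfWeight_zero
    have h1 := GradedShuffle.card_treesOfWeight_succ 0
    have h2 := GradedShuffle.card_treesOfWeight_succ 1
    have h3 := GradedShuffle.card_treesOfWeight_succ 2
    have h4 := GradedShuffle.card_treesOfWeight_succ 3
    have h5 := GradedShuffle.card_treesOfWeight_succ 4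
    have h6 := GradedShuffle.card_treesOfWeight_succ 5
    have h7 := GradedShuffle.card_treesOfWeight_succ 6
    have h8 := GradedShuffle.card_treesOfWeight_succ 7
    have h9 := GradedShuffle.card_treesOfWeight_succ 8
    simp only [Finset.Nat.sum_antidiagonal_eq_sum_range_succ_mk, Finset.sum_range_succ,
      Finset.sum_range_zero, zero_add, Nat.sub_zero, Nat.reduceSub, Nat.reduceAdd]
      at h1 h2 h3 h4 h5 h6 h7 h8 h9
    simp only [h0, mul_one] at h1
    simp only [h0, h1, mul_one, Nat.reduceAdd] at h2
    simp only [h0, h1, h2, mul_one, Nat.reduceMul, Nat.reduceAdd] at h3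
    simp only [h0, h1, h2, h3, Nat.reduceMul, Nat.reduceAdd] at h4
    simp only [h0, h1, h2, h3, h4, Nat.reduceMul, Nat.reduceAdd] at h5
    simp only [h0, h1, h2, h3, h4, h5, Nat.reduceMul, Nat.reduceAdd] at h6
    simp only [h0, h1, h2, h3, h4, h5, h6, Nat.reduceMul, Nat.reduceAdd] at h7
    simp only [h0, h1, h2, h3, h4, h5, h6, h7, Nat.reduceMul, Nat.reduceAdd] at h8
    simp only [h0, h1, h2, h3, h4, h5, h6, h7, h8, Nat.reduceMul, Nat.reduceAdd] at h9
    simp [List.range_succ, h0, h1, h2, h3, h4, h5, h6, h7, h8, h9]
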